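/- Let $\mathbb K$ be an algebraically closed field and let $G$ be a simple linear algebraic group over $\mathbb K$ (that is, a connected, non-commutative, Zariski closed subgroup of some $\mathrm{GL}_m(\mathbb K)$ with no closed connected normal subgroups other than $\{1\}$ and $G$). Let $T$ be a maximal torus of $G$, let $M$ be its character lattice, $M_{\mathbb Q}=M\otimes_{\mathbb Z}\mathbb Q$, and let $W=N_G(T)/T$ be the Weyl group. For $w\in W$ with representative $n_w\in N_G(T)$, let $\varphi_w\colon T\to T$, $\varphi_w(t)=n_wtn_w^{-1}$, and let $\tau(w)$ be the number of fixed points of $\varphi_w$ on $T$. The group $W$ acts linearly on $M_{\mathbb Q}$, and $w$ is called elliptic if it has no nonzero fixed vectors in $M_{\mathbb Q}$. Suppose that the root system $\Phi\subset M_{\mathbb Q}$ of $G$ with respect to $T$ is of type $\mathrm B_n$, $\mathrm C_n$ or $\mathrm D_n$, and fix a linear isomorphism $M_{\mathbb Q}\cong\mathbb Q^n$ carrying $\Phi$ onto the standard root system $\{\pm e_i\}\cup\{\pm e_i\pm e_j : i\ne j\}$, $\{\pm 2e_i\}\cup\{\pm e_i\pm e_j : i\neq j\}$ or $\{\pm e_i\pm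 e_j : i\neq j\}$, respectively. Let $w\in W$ be an elliptic element corresponding to the partition $n=n_1+\dots+n_h$ (with $h$ even in type $\mathrm D_n$); this means that $w$ acts on $\mathbb Q^n$ as a signed permutation $e_i\mapsto\pm e_{\pi(i)}$, where the permutation $\pi$ has cycle lengths $n_1,\dots,n_h$ (fixed points are cycles of length one). Then $$\tau(w)=2^h\quad\text{if } \operatorname{char}\mathbb K\neq 2,\qquad \tau(w)=1\quad\text{if } \operatorname{char}\mathbb K=2 .$$ -/

import Mathlib

open scoped TensorProduct

namespace TorusFixedPoints

noncomputable section

variable {K : Type*} [Field K] {m : ℕ}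

/-! ### Linear algebraic groups as Zariski closed subgroups of `GL_m(K)` -/

/-- The value of a polynomial in the matrix entries at an invertible matrix. -/
def evalAt (g : GL (Fin m) K) (f : MvPolynomial (Fin m × Fin m) K) : K :=
  MvPolynomial.eval (fun ij => g.val ij.1 ij.2) f

/-- A subset of `GL_m(K)` is Zariski closed if it is the zero locus in `GL_m(K)` of a set of
polynomials in the matrix entries. -/
def IsZariskiClosed (S : Set (GL (Fin m) K)) : Prop :=
  ∃ I : Set (MvPolynomial (Fin m × Fin m) K), S = {g | ∀ f ∈ I, evalAt g f = 0}

/-- A subgroup of `GL_m(K)` is connected in the Zariski topology: it is not the union of two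
disjoint nonempty relatively closed subsets. -/
def IsZariskiConnected (H : Subgroup (GL (Fin m) K)) : Prop :=
  ∀ A B : Set (GL (Fin m) K), IsZariskiClosed A → IsZariskiClosed B →
    (H : Set (GL (Fin m) K)) ⊆ A ∪ B → (H : Set (GL (Fin m) K)) ∩ (A ∩ B) = ∅ →
    (H : Set (GL (Fin m) K)) ⊆ A ∨ (H : Set (GL (Fin m) K)) ⊆ B

/-- A simple linear algebraic group: closed, connected, not commutative, and without closed
connected normal subgroups other than the trivial group and the group itself. -/
structure IsSimpleAlgebraicGroup (G : Subgroup (GL (Fin m) K)) : Prop where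
  closed : IsZariskiClosed (G : Set (GL (Fin m) K))
  connected : IsZariskiConnected G
  noncomm : ∃ g ∈ G, ∃ h ∈ G, g * h ≠ h * g
  simple : ∀ H : Subgroup (GL (Fin m) K), H ≤ G → IsZariskiClosed (H : Set (GL (Fin m) K)) →
    IsZariskiConnected H → (∀ g ∈ G, ∀ h ∈ H, g * h * g⁻¹ ∈ H) → H = ⊥ ∨ H = G

/-- The algebra of regular functions on a closed subgroup `H` of `GL_m(K)`, as `K`-valued
functions on `H`: it is generated by the matrix entries of `h` and of `h⁻¹`. -/
def regularFunctions (H : Subgroup (GL (Fin m) K)) : Subalgebra K (H → K) :=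
  Algebra.adjoin K
    ({u | ∃ i j, u = fun h : H => (h : GL (Fin m) K).val i j} ∪
     {u | ∃ i j, u = fun h : H => ((h : GL (Fin m) K)⁻¹).val i j})

/-- A map between subgroups of general linear groups is regular (a morphism of varieties) if
it pulls regular functions back to regular functions. -/
def IsRegularMap {m' : ℕ} {H : Subgroup (GL (Fin m) K)} {H' : Subgroup (GL (Fin m') K)}
    (f : H → H') : Prop :=
  ∀ u ∈ regularFunctions H', u ∘ f ∈ regularFunctions H

/-! ### Tori -/

/-- The group of invertible diagonal matrices, that is `(Kˣ)^r`. -/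
def diagonalTorus (K : Type*) [Field K] (r : ℕ) : Subgroup (GL (Fin r) K) :=
  ((Units.map (Matrix.diagonalRingHom (Fin r) K).toMonoidHom).comp
    (MulEquiv.piUnits (M := fun _ : Fin r => K)).symm.toMonoidHom).range

/-- A torus: a subgroup that is closed and isomorphic, as an algebraic group, to some `(Kˣ)^r`. -/
def IsTorus (T : Subgroup (GL (Fin m) K)) : Prop :=
  IsZariskiClosed (T : Set (GL (Fin m) K)) ∧
    ∃ (r : ℕ) (e : diagonalTorus K r ≃* T), IsRegularMap e ∧ IsRegularMap e.symm

/-- `T` is a maximal torus of `G`. -/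
structure IsMaximalTorus (G T : Subgroup (GL (Fin m) K)) : Prop where
  le : T ≤ G
  isTorus : IsTorus T
  maximal : ∀ T' : Subgroup (GL (Fin m) K), T' ≤ G → IsTorus T' → T ≤ T' → T' = T

lemma IsTorus.mul_comm {T : Subgroup (GL (Fin m) K)} (hT : IsTorus T) (s t : T) :
    s * t = t * s := by
  obtain ⟨-, r, e, -, -⟩ := hT
  have h : ∀ a b : diagonalTorus K r, a * b = b * a := by
    rintro ⟨_, x, rfl⟩ ⟨_, y, rfl⟩
    apply Subtype.ext
    change _ * _ = _ * _
    rw [← map_mul, ← map_mul, _root_.mul_comm]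
  apply e.symm.injective
  rw [map_mul, map_mul, h]

/-- The character group of `T`: homomorphisms `T → Kˣ` that are regular functions on `T`. -/
def charGroup (T : Subgroup (GL (Fin m) K)) : Subgroup (T →* Kˣ) where
  carrier := {χ | (fun t => (χ t : K)) ∈ regularFunctions T}
  one_mem' := by
    exact (regularFunctions T).one_mem
  mul_mem' {χ ψ} hχ hψ := by
    have h := (regularFunctions T).mul_mem hχ hψ
    simpa [Pi.mul_def] using h
  inv_mem' {χ} hχ := by
    have key : ∀ u ∈ regularFunctions T, (fun t : T => u t⁻¹) ∈ regularFunctions T := by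
      intro u hu
      induction hu using Algebra.adjoin_induction with
      | mem x hx =>
        apply Algebra.subset_adjoin
        rcases hx with ⟨i, j, rfl⟩ | ⟨i, j, rfl⟩
        · exact Or.inr ⟨i, j, by simp⟩
        · exact Or.inl ⟨i, j, by simp⟩
      | algebraMap r => exact (regularFunctions T).algebraMap_mem r
      | add x y _ _ hx hy => exact (regularFunctions T).add_mem hx hy
      | mul x y _ _ hx hy => exact (regularFunctions T).mul_mem hx hy
    have h := key _ hχ
    simpa using h

/-- The rational vector space `M_ℚ = M ⊗ ℚ` spanned by the character lattice `M` of `T`. -/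
abbrev RatChar (T : Subgroup (GL (Fin m) K)) : Type _ := ℚ ⊗[ℤ] Additive (charGroup T)

/-! ### Roots -/

/-- The Lie algebra of a closed subgroup `G` of `GL_m(K)`: the tangent space at the identity,
cut out by the differentials at `1` of all polynomials vanishing on `G`. -/
def lieAlg (G : Subgroup (GL (Fin m) K)) : Set (Matrix (Fin m) (Fin m) K) :=
  {X | ∀ f : MvPolynomial (Fin m × Fin m) K, (∀ g ∈ G, evalAt g f = 0) →
    ∑ ij : Fin m × Fin m, X ij.1 ij.2 * evalAt 1 (MvPolynomial.pderiv ij f) = 0}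

/-- The root system of `G` with respect to `T`: the nontrivial characters of `T` that occur as
weights of the adjoint action of `T` on the Lie algebra of `G`. -/
def roots (G T : Subgroup (GL (Fin m) K)) : Set (charGroup T) :=
  {α | α ≠ 1 ∧ ∃ X ∈ lieAlg G, X ≠ 0 ∧
    ∀ t : T, (t : GL (Fin m) K).val * X * ((t : GL (Fin m) K)⁻¹).val = (α.1 t : K) • X}

/-- The root system of `G` with respect to `T`, as a subset of `M_ℚ`. -/
def ratRoots (G T : Subgroup (GL (Fin m) K)) : Set (RatChar T) :=
  (fun α : charGroup T => (1 : ℚ) ⊗ₜ[ℤ] Additive.ofMul α) '' roots G T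

/-- The three infinite series of root systems under consideration. -/
inductive ClassicalType
  | B
  | C
  | D

/-- The standard vectors `e_i` of `ℚ^n`. -/
abbrev stdVec {n : ℕ} (i : Fin n) : Fin n → ℚ := Pi.single i 1

/-- The vectors `± e_i ± e_j`, `i ≠ j`. -/
def rootsD (n : ℕ) : Set (Fin n → ℚ) :=
  {v | ∃ i j : Fin n, i ≠ j ∧
    (v = stdVec i + stdVec j ∨ v = stdVec i - stdVec j ∨ v = -stdVec i - stdVec j)}

/-- The standard root systems `B_n`, `C_n`, `D_n` in `ℚ^n`. -/
def stdRoots (n : ℕ) : ClassicalType → Set (Fin n → ℚ)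
  | .B => rootsD n ∪ {v | ∃ i, v = stdVec i ∨ v = -stdVec i}
  | .C => rootsD n ∪ {v | ∃ i, v = (2 : ℚ) • stdVec i ∨ v = -((2 : ℚ) • stdVec i)}
  | .D => rootsD n

/-- A linear isomorphism `M_ℚ ≃ ℚ^n` identifying the root system of `G` with the standard root
system of the given type. -/
def IsRootIso (G T : Subgroup (GL (Fin m) K)) (n : ℕ) (Φ : ClassicalType)
    (e : RatChar T ≃ₗ[ℚ] (Fin n → ℚ)) : Prop :=
  e '' ratRoots G T = stdRoots n Φ

/-! ### The Weyl group and its action on the torus -/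

/-- The normalizer `N_G(T)`. -/
def torusNormalizer (G T : Subgroup (GL (Fin m) K)) : Subgroup (GL (Fin m) K) :=
  G ⊓ Subgroup.normalizer (T : Set (GL (Fin m) K))

instance torusNormalizer_normal (G T : Subgroup (GL (Fin m) K)) :
    (T.subgroupOf (torusNormalizer G T)).Normal :=
  Subgroup.normal_subgroupOf_of_le_normalizer inf_le_right

/-- The Weyl group `W = N_G(T) / T`. -/
abbrev Weyl (G T : Subgroup (GL (Fin m) K)) : Type _ :=
  torusNormalizer G T ⧸ T.subgroupOf (torusNormalizer G T)

/-- Conjugation `t ↦ n t n⁻¹` of `T` by elements of `N_G(T)`. -/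
def conjTorus (G T : Subgroup (GL (Fin m) K)) : torusNormalizer G T →* MulAut T :=
  T.normalizerMonoidHom.comp (Subgroup.inclusion inf_le_right)

lemma conjTorus_apply (G T : Subgroup (GL (Fin m) K)) (n : torusNormalizer G T) (t : T) :
    ((conjTorus G T n t : T) : GL (Fin m) K) = n * t * (n : GL (Fin m) K)⁻¹ := rfl

/-- The automorphism `φ_w` of `T`, `φ_w(t) = n_w t n_w⁻¹`, where `n_w` is any element of `N_G(T)`
representing `w ∈ W`. -/
def weylAut (G : Subgroup (GL (Fin m) K)) {T : Subgroup (GL (Fin m) K)} (hT : IsTorus T) :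
    Weyl G T →* MulAut T :=
  QuotientGroup.lift (T.subgroupOf (torusNormalizer G T)) (conjTorus G T) (by
    intro n hn
    ext1 t
    have h := hT.mul_comm ⟨n, hn⟩ t
    apply Subtype.ext
    rw [conjTorus_apply, mul_inv_eq_iff_eq_mul]
    exact congrArg Subtype.val h)

lemma weylAut_mk (G : Subgroup (GL (Fin m) K)) {T : Subgroup (GL (Fin m) K)} (hT : IsTorus T)
    (n : torusNormalizer G T) (t : T) :
    ((weylAut G hT (n : Weyl G T) t : T) : GL (Fin m) K) = n * t * (n : GL (Fin m) K)⁻¹ := rfl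

lemma weylAut_regular (G : Subgroup (GL (Fin m) K)) {T : Subgroup (GL (Fin m) K)}
    (hT : IsTorus T) (w : Weyl G T) : IsRegularMap (weylAut G hT w) := by
  induction w using QuotientGroup.induction_on with | H n => ?_
  have key : ∀ (a b : Matrix (Fin m) (Fin m) K) (f : T → Matrix (Fin m) (Fin m) K),
      (∀ k l, (fun t => f t k l) ∈ regularFunctions T) →
      ∀ i j, (fun t => (a * f t * b) i j) ∈ regularFunctions T := by
    intro a b f hf i j
    have h : (fun t => (a * f t * b) i j) =
        ∑ l, ∑ k, (a i k * b l j) • (fun t => f t k l) := by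
      funext t
      simp only [Matrix.mul_apply, Finset.sum_mul, Finset.sum_apply, Pi.smul_apply, smul_eq_mul]
      exact Finset.sum_congr rfl fun l _ => Finset.sum_congr rfl fun k _ => by ring
    rw [h]
    exact sum_mem fun l _ => sum_mem fun k _ => (regularFunctions T).smul_mem (hf k l) _
  intro u hu
  induction hu using Algebra.adjoin_induction with
  | mem x hx =>
    rcases hx with ⟨i, j, rfl⟩ | ⟨i, j, rfl⟩
    · exact key (n : GL (Fin m) K).val ((n : GL (Fin m) K)⁻¹).val
        (fun t => (t : GL (Fin m) K).val)
        (fun k l => Algebra.subset_adjoin (Or.inl ⟨k, l, rfl⟩)) i j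
    · have h := key (n : GL (Fin m) K).val ((n : GL (Fin m) K)⁻¹).val
        (fun t => ((t : GL (Fin m) K)⁻¹).val)
        (fun k l => Algebra.subset_adjoin (Or.inr ⟨k, l, rfl⟩)) i j
      convert h using 1
      funext t
      have e : ((weylAut G hT (n : Weyl G T) t : T) : GL (Fin m) K)⁻¹ =
          n * (t : GL (Fin m) K)⁻¹ * (n : GL (Fin m) K)⁻¹ := by
        rw [weylAut_mk]; group
      change (((weylAut G hT (n : Weyl G T) t : T) : GL (Fin m) K)⁻¹).val i j = _
      rw [e]
      rfl
  | algebraMap r => exact (regularFunctions T).algebraMap_mem r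
  | add x y _ _ hx hy => exact (regularFunctions T).add_mem hx hy
  | mul x y _ _ hx hy => exact (regularFunctions T).mul_mem hx hy

/-- The action of `W` on the character lattice: `(w χ)(t) = χ(φ_w⁻¹(t))`. -/
def weylChar (G : Subgroup (GL (Fin m) K)) {T : Subgroup (GL (Fin m) K)} (hT : IsTorus T)
    (w : Weyl G T) : charGroup T →* charGroup T where
  toFun χ := ⟨χ.1.comp (weylAut G hT w⁻¹).toMonoidHom, weylAut_regular G hT w⁻¹ _ χ.2⟩
  map_one' := rfl
  map_mul' _ _ := rfl

/-- The standard linear representation of `W` in `M_ℚ`. -/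
def stdRep (G : Subgroup (GL (Fin m) K)) {T : Subgroup (GL (Fin m) K)} (hT : IsTorus T) :
    Representation ℚ (Weyl G T) (RatChar T) where
  toFun w := (weylChar G hT w).toAdditive.toIntLinearMap.baseChange ℚ
  map_one' := by
    have h : (weylChar G hT 1).toAdditive.toIntLinearMap = LinearMap.id := by
      refine LinearMap.ext fun χ => Additive.toMul.injective (Subtype.ext (MonoidHom.ext fun t => ?_))
      simp [weylChar]
    rw [h, LinearMap.baseChange_id]
    rfl
  map_mul' v w := by
    have h : (weylChar G hT (v * w)).toAdditive.toIntLinearMap =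
        (weylChar G hT v).toAdditive.toIntLinearMap ∘ₗ
          (weylChar G hT w).toAdditive.toIntLinearMap := by
      refine LinearMap.ext fun χ => Additive.toMul.injective (Subtype.ext (MonoidHom.ext fun t => ?_))
      simp [weylChar]
    rw [h, LinearMap.baseChange_comp]
    rfl

/-- `w ∈ W` is elliptic if it has no nonzero fixed vectors in the standard representation. -/
def IsElliptic (G : Subgroup (GL (Fin m) K)) {T : Subgroup (GL (Fin m) K)} (hT : IsTorus T)
    (w : Weyl G T) : Prop :=
  ∀ x : RatChar T, stdRep G hT w x = x → x = 0

/-- Under the identification `e : M_ℚ ≃ ℚ^n`, the element `w` acts as a signed permutation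
`e_i ↦ ± e_{π(i)}` of the standard basis, and the cycle lengths of `π` (fixed points being cycles
of length one) are the parts of the partition `p` of `n`. -/
def CorrespondsTo (G : Subgroup (GL (Fin m) K)) {T : Subgroup (GL (Fin m) K)} (hT : IsTorus T)
    {n : ℕ} (e : RatChar T ≃ₗ[ℚ] (Fin n → ℚ)) (w : Weyl G T) (p : n.Partition) : Prop :=
  ∃ (π : Equiv.Perm (Fin n)) (ε : Fin n → ℤˣ),
    (∀ i, e (stdRep G hT w (e.symm (stdVec i))) = ((ε i : ℤ) : ℚ) • stdVec (π i)) ∧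
    π.partition.parts = p.parts

/-- The number `τ(w)` of fixed points of `φ_w` on `T` (`Nat.card`, so `0` for an infinite set). -/
def tau (G : Subgroup (GL (Fin m) K)) {T : Subgroup (GL (Fin m) K)} (hT : IsTorus T)
    (w : Weyl G T) : ℕ :=
  Nat.card {t : T // weylAut G hT w t = t}

end

end TorusFixedPoints

/-! A torus is dual to its character lattice M: points of T are the homomorphisms M → Kˣ
(`existsUnique_forall_charGroup_eq`). A point is fixed by w exactly when every character in (w - 1)M
is trivial on it, so the fixed points are Hom(M/(w - 1)M, Kˣ) (`card_annihilator`).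

The lattice M depends on G and need not correspond to ℤ^n inside ℚ^n. The order of M/(w - 1)M is
nevertheless |det(w - 1)|, which can be computed over ℚ, hence on ℤ^n with the signed permutation
matrix A (`card_quotient_range_sub_id`). Ellipticity makes each e_i go to -e_i under some power of
A, so ℤ^n/(A - 1)ℤ^n is one copy of ℤ/2 per cycle (`range_toLin'_signedPermMatrix_sub_one`), of
order 2^h.

A finite abelian group of order 2^h has 2^h homomorphisms to Kˣ when 2 is invertible in K, and only
the trivial one in characteristic 2. -/

namespace TorusFixedPoints

noncomputable section

variable {K : Type*} [Field K] {m : ℕ}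

open scoped Matrix

/-! ### Signed permutation matrices -/

section SignedPerm

variable {ι : Type*} [DecidableEq ι]

/-- The matrix of the linear map `e_i ↦ ε_i e_{π(i)}`. -/
def signedPermMatrix (R : Type*) [CommRing R] (π : Equiv.Perm ι) (ε : ι → ℤˣ) : Matrix ι ι R :=
  Matrix.of fun j i => if π i = j then ((ε i : ℤ) : R) else 0

lemma signedPermMatrix_map_intCast (R : Type*) [CommRing R] (π : Equiv.Perm ι) (ε : ι → ℤˣ) :
    (signedPermMatrix ℤ π ε).map (Int.castRingHom R) = signedPermMatrix R π ε := by
  ext i j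
  simp only [signedPermMatrix, Matrix.map_apply, Matrix.of_apply]
  split_ifs <;> simp

variable [Fintype ι]

lemma signedPermMatrix_mulVec_single (R : Type*) [CommRing R] (π : Equiv.Perm ι) (ε : ι → ℤˣ)
    (i : ι) :
    signedPermMatrix R π ε *ᵥ Pi.single i 1 = ((ε i : ℤ) : R) • Pi.single (π i) 1 := by
  ext j
  simp [signedPermMatrix, Pi.single_apply, eq_comm]

lemma signedPermMatrix_pow_mulVec_single (π : Equiv.Perm ι) (ε : ι → ℤˣ) (i : ι) (k : ℕ) :
    ∃ s : ℤˣ, signedPermMatrix ℤ π ε ^ k *ᵥ Pi.single i 1 =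
      (s : ℤ) • (Pi.single ((π ^ k) i) 1 : ι → ℤ) := by
  induction k with
  | zero => exact ⟨1, by rw [pow_zero, pow_zero, Matrix.one_mulVec]; simp⟩
  | succ k ih =>
    obtain ⟨s, hs⟩ := ih
    refine ⟨s * ε ((π ^ k) i), ?_⟩
    rw [pow_succ', ← Matrix.mulVec_mulVec, hs, Matrix.mulVec_smul,
      signedPermMatrix_mulVec_single, smul_smul, pow_succ', Equiv.Perm.mul_apply]
    simp

/-- If a signed permutation matrix has no nonzero fixed vector, then each standard vector is
carried to its negative by some power of the matrix. -/
lemma exists_signedPermMatrix_pow_mulVec_eq_neg {π : Equiv.Perm ι} {ε : ι → ℤˣ}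
    (h : ∀ x : ι → ℤ, signedPermMatrix ℤ π ε *ᵥ x = x → x = 0) (i : ι) :
    ∃ k, signedPermMatrix ℤ π ε ^ k *ᵥ Pi.single i 1 = -(Pi.single i 1 : ι → ℤ) := by
  by_contra! hk
  set A := signedPermMatrix ℤ π ε with hA
  have hN : A ^ orderOf π *ᵥ Pi.single i 1 = (Pi.single i 1 : ι → ℤ) := by
    obtain ⟨s, hs⟩ := signedPermMatrix_pow_mulVec_single π ε i (orderOf π)
    rw [pow_orderOf_eq_one] at hs
    rcases Int.units_eq_one_or s with rfl | rfl
    · simpa using hs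
    · exact absurd (by simpa using hs) (hk (orderOf π))
  -- This coordinate is 0 or ±1, and -1 would give a power excluded by `hk`.
  have hnonneg : ∀ k, 0 ≤ (A ^ k *ᵥ (Pi.single i 1 : ι → ℤ)) i := by
    intro k
    obtain ⟨s, hs⟩ := signedPermMatrix_pow_mulVec_single π ε i k
    have hk' := hk k
    rw [← hA] at hs
    rw [hs] at hk' ⊢
    rcases eq_or_ne ((π ^ k) i) i with hi | hi
    · rcases Int.units_eq_one_or s with rfl | rfl
      · simp [hi]
      · simp [hi] at hk'
    · simp [hi.symm]
  -- Since `A ^ orderOf π` fixes e_i, applying `A` only shifts the orbit sum cyclically. It is thus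
  -- a fixed vector and vanishes, although its i-th coordinate is positive because of the term k =
  -- 0.
  have hfix : ∑ k ∈ Finset.range (orderOf π), A ^ k *ᵥ (Pi.single i 1 : ι → ℤ) = 0 := by
    apply h
    rw [Matrix.mulVec_sum]
    simp only [Matrix.mulVec_mulVec, ← pow_succ']
    have := Finset.sum_range_succ' (fun k => A ^ k *ᵥ (Pi.single i 1 : ι → ℤ)) (orderOf π)
    rw [Finset.sum_range_succ, hN] at this
    rw [pow_zero, Matrix.one_mulVec] at this
    exact (add_right_cancel this).symm
  have hpos : 0 < ∑ k ∈ Finset.range (orderOf π), (A ^ k *ᵥ (Pi.single i 1 : ι → ℤ)) i :=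
    Finset.sum_pos' (fun k _ => hnonneg k)
      ⟨0, Finset.mem_range.2 (orderOf_pos π), by simp⟩
  have := congrFun hfix i
  rw [Finset.sum_apply] at this
  exact hpos.ne' this

open Classical in
/-- The parity of the sum of the coordinates along each orbit of a permutation. -/
def orbitParity {ι : Type*} [Fintype ι] (π : Equiv.Perm ι) :
    (ι → ℤ) →ₗ[ℤ] (Quotient (Equiv.Perm.SameCycle.setoid π) → ZMod 2) where
  toFun x o := ((∑ i with Quotient.mk (Equiv.Perm.SameCycle.setoid π) i = o, x i : ℤ) : ZMod 2)
  map_add' x y := by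
    ext o; simp [Finset.sum_add_distrib]
  map_smul' c x := by
    ext o; simp [← Finset.mul_sum]

open Classical in
lemma orbitParity_apply {ι : Type*} [Fintype ι] (π : Equiv.Perm ι) (x : ι → ℤ)
    (o : Quotient (Equiv.Perm.SameCycle.setoid π)) :
    orbitParity π x o =
      ((∑ i with Quotient.mk (Equiv.Perm.SameCycle.setoid π) i = o, x i : ℤ) : ZMod 2) := rfl

open Classical in
lemma orbitParity_single (π : Equiv.Perm ι) (i : ι) :
    orbitParity π (Pi.single i 1) = Pi.single (Quotient.mk _ i) 1 := by
  ext o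
  rw [orbitParity_apply, Finset.sum_filter, Finset.sum_eq_single i]
  · simp [Pi.single_apply, eq_comm]
  · intro j _ hj
    simp [hj]
  · simp

lemma orbitParity_surjective (π : Equiv.Perm ι) : Function.Surjective (orbitParity π) := by
  classical
  intro y
  -- An integer lift of `y`, supported on one representative of each orbit.
  refine ⟨∑ o, (ZMod.cast (y o) : ℤ) • Pi.single o.out 1, ?_⟩
  simp only [map_sum, map_smul, orbitParity_single, Quotient.out_eq]
  ext o
  simp [Finset.sum_apply, Pi.single_apply, -ZMod.intCast_cast, ZMod.intCast_zmod_cast]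

/-- Signs are invisible mod 2 and `π` preserves orbits, so the image of A - 1 has even orbit sums.
Conversely, A acts trivially modulo its image N, so basis vectors in one orbit agree there up to
sign. Each is also congruent to its own negative, so the signs disappear and only orbit sums mod 2
survive. -/
lemma range_toLin'_signedPermMatrix_sub_one {π : Equiv.Perm ι} {ε : ι → ℤˣ}
    (h : ∀ x : ι → ℤ, signedPermMatrix ℤ π ε *ᵥ x = x → x = 0) :
    LinearMap.range (Matrix.toLin' (signedPermMatrix ℤ π ε - 1)) =
      LinearMap.ker (orbitParity π) := by
  classical
  set A := signedPermMatrix ℤ π ε with hA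
  apply le_antisymm
  · rw [LinearMap.range_le_ker_iff]
    refine (Pi.basisFun ℤ ι).ext fun i => ?_
    rw [LinearMap.comp_apply, Pi.basisFun_apply, Matrix.toLin'_apply, Matrix.sub_mulVec,
      Matrix.one_mulVec, map_sub, hA, signedPermMatrix_mulVec_single, map_smul,
      orbitParity_single, orbitParity_single]
    have hi : Quotient.mk (Equiv.Perm.SameCycle.setoid π) (π i) = Quotient.mk _ i :=
      Quotient.sound (Equiv.Perm.sameCycle_apply_left.2 (Equiv.Perm.SameCycle.refl π i))
    rw [hi]
    rcases Int.units_eq_one_or (ε i) with h1 | h1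
    · simp [h1]
    · rw [h1]
      rw [Units.val_neg, Units.val_one, Int.cast_neg, Int.cast_one, neg_smul, one_smul]
      ext o
      have hz : ∀ a : ZMod 2, -a - a = 0 := by decide
      exact hz _
  · intro x hx
    set N := LinearMap.range (Matrix.toLin' (A - 1)) with hN
    have hq : ∀ y, N.mkQ (A *ᵥ y) = N.mkQ y := by
      intro y
      rw [← sub_eq_zero, ← map_sub, Submodule.mkQ_apply, Submodule.Quotient.mk_eq_zero]
      exact ⟨y, by simp⟩
    have hqk : ∀ k y, N.mkQ (A ^ k *ᵥ y) = N.mkQ y := by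
      intro k y
      induction k with
      | zero => simp
      | succ k ih => rw [pow_succ', ← Matrix.mulVec_mulVec, hq, ih]
    have hneg : ∀ i, N.mkQ (Pi.single i 1) = -N.mkQ (Pi.single i 1) := by
      intro i
      obtain ⟨k, hk⟩ := exists_signedPermMatrix_pow_mulVec_eq_neg h i
      rw [← map_neg, ← hk, hqk]
    have hstep : ∀ i j, Equiv.Perm.SameCycle π i j →
        N.mkQ (Pi.single i 1) = N.mkQ (Pi.single j 1) := by
      rintro i j hij
      obtain ⟨k, -, rfl⟩ := hij.exists_pow_eq'
      obtain ⟨s, hs⟩ := signedPermMatrix_pow_mulVec_single π ε i k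
      rw [← hqk k, hs, map_smul]
      rcases Int.units_eq_one_or s with rfl | rfl
      · simp
      · rw [Units.val_neg, Units.val_one, neg_smul, one_smul, ← hneg]
    let g : Quotient (Equiv.Perm.SameCycle.setoid π) → (ι → ℤ) ⧸ N :=
      Quotient.lift (fun i => N.mkQ (Pi.single i 1)) hstep
    have hg : ∀ o, g o + g o = 0 := by
      rintro ⟨i⟩
      exact eq_neg_iff_add_eq_zero.1 (hneg i)
    have hx' : N.mkQ x = 0 := by
      calc N.mkQ x = ∑ i, x i • g (Quotient.mk _ i) := by
            conv_lhs => rw [pi_eq_sum_univ' x]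
            rw [map_sum]
            refine Finset.sum_congr rfl fun i _ => ?_
            rw [map_smul]
            congr 2
        _ = ∑ o, (∑ i with Quotient.mk (Equiv.Perm.SameCycle.setoid π) i = o, x i) • g o := by
            rw [← Finset.sum_fiberwise (g := Quotient.mk (Equiv.Perm.SameCycle.setoid π))]
            refine Finset.sum_congr rfl fun o _ => ?_
            rw [Finset.sum_smul]
            refine Finset.sum_congr rfl fun i hi => ?_
            rw [(Finset.mem_filter.1 hi).2]
        _ = 0 := by
            refine Finset.sum_eq_zero fun o _ => ?_
            have ho := congrFun (LinearMap.mem_ker.1 hx) o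
            rw [orbitParity_apply, Pi.zero_apply, ZMod.intCast_zmod_eq_zero_iff_dvd] at ho
            obtain ⟨c, hc⟩ := ho
            rw [hc]
            push_cast
            rw [mul_comm, mul_smul, two_smul, hg, smul_zero]
    rwa [Submodule.mkQ_apply, Submodule.Quotient.mk_eq_zero] at hx'

lemma card_quotient_range_signedPermMatrix_sub_one {π : Equiv.Perm ι} {ε : ι → ℤˣ}
    (h : ∀ x : ι → ℤ, signedPermMatrix ℤ π ε *ᵥ x = x → x = 0) :
    Nat.card ((ι → ℤ) ⧸ LinearMap.range (Matrix.toLin' (signedPermMatrix ℤ π ε - 1))) =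
      2 ^ Nat.card (Quotient (Equiv.Perm.SameCycle.setoid π)) := by
  rw [range_toLin'_signedPermMatrix_sub_one h,
    Nat.card_congr ((orbitParity π).quotKerEquivOfSurjective (orbitParity_surjective π)).toEquiv,
    Nat.card_fun, Nat.card_zmod]

/-- The number of orbits of a permutation is the number of parts of its cycle partition. -/
lemma card_quotient_sameCycle (π : Equiv.Perm ι) :
    Nat.card (Quotient (Equiv.Perm.SameCycle.setoid π)) = π.partition.parts.card := by
  classical
  have hne : ∀ c : π.cycleFactorsFinset, ∃ x, x ∈ c.1.support := fun c =>
    Finset.nonempty_iff_ne_empty.2 fun hc =>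
      (Equiv.Perm.mem_cycleFactorsFinset_iff.1 c.2).1.ne_one
        (Equiv.Perm.support_eq_empty_iff.1 hc)
  choose x hx using hne
  have hxc : ∀ c, c.1 = π.cycleOf (x c) := fun c => Equiv.Perm.cycle_is_cycleOf (hx c) c.2
  have hxs : ∀ c, π (x c) ≠ x c := fun c =>
    Equiv.Perm.mem_support.1 (Equiv.Perm.mem_cycleFactorsFinset_support_le c.2 (hx c))
  -- Orbits are nontrivial cycles or fixed points, matching `partition`, which adds a part 1 to the
  -- cycle type for each fixed point.
  let f : π.cycleFactorsFinset ⊕ Function.fixedPoints π →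
      Quotient (Equiv.Perm.SameCycle.setoid π) :=
    Sum.elim (fun c => Quotient.mk _ (x c)) (fun i => Quotient.mk _ i.1)
  have hfix : ∀ (i : Function.fixedPoints π) j, π.SameCycle i.1 j → i.1 = j := fun i j hij =>
    hij.eq_of_left i.2
  have hf : Function.Bijective f := by
    constructor
    · rintro (c | i) (d | j) h
      · have h' : π.SameCycle (x c) (x d) := Quotient.exact h
        exact congrArg _ (Subtype.ext (by rw [hxc c, hxc d, h'.cycleOf_eq]))
      · have h' : π.SameCycle (x c) j.1 := Quotient.exact h
        exact absurd (hfix j _ h'.symm ▸ j.2 : π (x c) = x c) (hxs c)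
      · have h' : π.SameCycle i.1 (x d) := Quotient.exact h
        exact absurd (hfix i _ h' ▸ i.2 : π (x d) = x d) (hxs d)
      · exact congrArg _ (Subtype.ext (hfix i _ (Quotient.exact h)))
    · rintro ⟨i⟩
      by_cases hi : π i = i
      · exact ⟨Sum.inr ⟨i, hi⟩, rfl⟩
      · refine ⟨Sum.inl ⟨π.cycleOf i, Equiv.Perm.cycleOf_mem_cycleFactorsFinset_iff.2
          (Equiv.Perm.mem_support.2 hi)⟩, Quotient.sound ?_⟩
        exact ((Equiv.Perm.mem_support_cycleOf_iff' hi).1 (hx ⟨π.cycleOf i, _⟩)).symm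
  rw [← Nat.card_eq_of_bijective f hf, Nat.card_sum, Equiv.Perm.parts_partition,
    Multiset.card_add, Multiset.card_replicate, Nat.card_eq_fintype_card,
    Nat.card_eq_fintype_card, Equiv.Perm.card_fixedPoints, Equiv.Perm.sum_cycleType,
    Equiv.Perm.cycleType_def, Multiset.card_map, Fintype.card_coe]
  rfl

end SignedPerm

/-! ### Lattices -/

lemma natAbs_det_eq_card_quotient_range {M : Type*} [AddCommGroup M] [Module.Free ℤ M]
    [Module.Finite ℤ M] (f : M →ₗ[ℤ] M) (hf : Function.Injective f) :
    (LinearMap.det f).natAbs = Nat.card (M ⧸ LinearMap.range f) :=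
  Submodule.natAbs_det_equiv (LinearMap.range f) (LinearEquiv.ofInjective f hf)

/-- If an endomorphism of a lattice becomes a signed permutation of `ℚ^n` over `ℚ` and has no
nonzero fixed vectors, the index of its displacement lattice is `2` to the number of cycles. -/
lemma card_quotient_range_sub_id {M : Type*} [AddCommGroup M] [Module.Free ℤ M]
    [Module.Finite ℤ M] (f : M →ₗ[ℤ] M) {ι : Type*} [Fintype ι] [DecidableEq ι]
    (e : ℚ ⊗[ℤ] M ≃ₗ[ℚ] (ι → ℚ)) (π : Equiv.Perm ι) (ε : ι → ℤˣ)
    (hf : ∀ i, e (f.baseChange ℚ (e.symm (Pi.single i 1))) =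
      ((ε i : ℤ) : ℚ) • Pi.single (π i) 1)
    (hfix : ∀ x, f.baseChange ℚ x = x → x = 0) :
    Nat.card (M ⧸ LinearMap.range (f - LinearMap.id)) = 2 ^ π.partition.parts.card := by
  have hconj : e.toLinearMap ∘ₗ f.baseChange ℚ ∘ₗ e.symm.toLinearMap =
      Matrix.toLin' (signedPermMatrix ℚ π ε) := by
    refine (Pi.basisFun ℚ ι).ext fun i => ?_
    rw [Pi.basisFun_apply, Matrix.toLin'_apply, signedPermMatrix_mulVec_single]
    exact hf i
  have hconj' : e.toLinearMap ∘ₗ (f - LinearMap.id).baseChange ℚ ∘ₗ e.symm.toLinearMap =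
      Matrix.toLin' (signedPermMatrix ℚ π ε - 1) := by
    rw [map_sub, ← hconj, Matrix.toLin'_one, LinearMap.baseChange_sub, LinearMap.baseChange_id]
    ext
    simp
  -- Extension to ℚ and conjugation by `e` preserve the determinant, so no map between `M` and the
  -- integral lattice in `ι → ℚ` is required.
  have hdet : LinearMap.det (f - LinearMap.id) = (signedPermMatrix ℤ π ε - 1).det := by
    have h1 := LinearMap.det_conj ((f - LinearMap.id).baseChange ℚ) e
    rw [hconj', LinearMap.det_toLin', LinearMap.det_baseChange] at h1
    have h2 : (signedPermMatrix ℚ π ε - 1).det =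
        Int.castRingHom ℚ (signedPermMatrix ℤ π ε - 1).det := by
      rw [RingHom.map_det, map_sub, map_one, RingHom.mapMatrix_apply,
        signedPermMatrix_map_intCast]
    rw [h2] at h1
    exact (Int.cast_injective (α := ℚ) h1).symm
  have hdet0 : LinearMap.det (f - LinearMap.id) ≠ 0 := by
    intro h0
    have h1 : LinearMap.det ((f - LinearMap.id).baseChange ℚ) = 0 := by
      rw [LinearMap.det_baseChange, h0, map_zero]
    refine LinearMap.det_eq_zero_iff_ker_ne_bot.1 h1 ?_
    refine LinearMap.ker_eq_bot'.2 fun x hx => hfix x ?_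
    rw [LinearMap.baseChange_sub, LinearMap.baseChange_id] at hx
    exact sub_eq_zero.1 hx
  have hinj : Function.Injective (f - LinearMap.id : M →ₗ[ℤ] M) := by
    rw [← LinearMap.ker_eq_bot]
    by_contra h
    exact hdet0 (LinearMap.det_eq_zero_iff_ker_ne_bot.2 h)
  have hne : (signedPermMatrix ℤ π ε - 1).det ≠ 0 := hdet ▸ hdet0
  -- The absence of fixed vectors passes to the integral matrix through its nonzero determinant.
  have hfixA : ∀ x : ι → ℤ, signedPermMatrix ℤ π ε *ᵥ x = x → x = 0 := fun x hx =>
    Matrix.eq_zero_of_mulVec_eq_zero hne (by rw [Matrix.sub_mulVec, hx, Matrix.one_mulVec, sub_self])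
  have hA : Function.Injective (Matrix.toLin' (signedPermMatrix ℤ π ε - 1)) :=
    Matrix.mulVec_injective_of_det_ne_zero hne
  rw [← natAbs_det_eq_card_quotient_range _ hinj,
    ← card_quotient_sameCycle, ← card_quotient_range_signedPermMatrix_sub_one hfixA,
    ← natAbs_det_eq_card_quotient_range _ hA]
  rw [hdet, LinearMap.det_toLin']

/-! ### Characters of tori -/

/-- The embedding of `(Kˣ)^r` into `GL_r(K)` as diagonal matrices. -/
def diagonalHom (K : Type*) [Field K] (r : ℕ) : (Fin r → Kˣ) →* GL (Fin r) K :=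
  (Units.map (Matrix.diagonalRingHom (Fin r) K).toMonoidHom).comp
    (MulEquiv.piUnits (M := fun _ : Fin r => K)).symm.toMonoidHom

lemma diagonalHom_val {r : ℕ} (x : Fin r → Kˣ) :
    (diagonalHom K r x).val = Matrix.diagonal fun i => (x i : K) := rfl

lemma diagonalHom_injective (K : Type*) [Field K] (r : ℕ) :
    Function.Injective (diagonalHom K r) := by
  intro x y h
  have h' := congrArg Units.val h
  rw [diagonalHom_val, diagonalHom_val] at h'
  exact funext fun i => Units.ext (congrFun (Matrix.diagonal_injective h') i)

/-- The coordinates of the diagonal torus. -/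
def diagonalEquiv (K : Type*) [Field K] (r : ℕ) : (Fin r → Kˣ) ≃* diagonalTorus K r :=
  MonoidHom.ofInjective (f := diagonalHom K r) (diagonalHom_injective K r)

lemma diagonalEquiv_val {r : ℕ} (x : Fin r → Kˣ) :
    (diagonalEquiv K r x : GL (Fin r) K) = diagonalHom K r x := rfl

/-- The Laurent monomials `x ↦ ∏ x_i ^ a_i`, as characters of `(Kˣ)^r`. -/
def monomialChar (K : Type*) [Field K] {r : ℕ} (a : Fin r → ℤ) : (Fin r → Kˣ) →* Kˣ where
  toFun x := ∏ i, x i ^ a i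
  map_one' := by simp
  map_mul' x y := by simp [mul_zpow, Finset.prod_mul_distrib]

lemma monomialChar_apply {r : ℕ} (a : Fin r → ℤ) (x : Fin r → Kˣ) :
    monomialChar K a x = ∏ i, x i ^ a i := rfl

lemma monomialChar_single {r : ℕ} (i : Fin r) (k : ℤ) (x : Fin r → Kˣ) :
    monomialChar K (Pi.single i k) x = x i ^ k := by
  rw [monomialChar_apply, Finset.prod_eq_single i]
  · simp
  · intro j _ hj; simp [hj]
  · simp

/-- The Laurent monomials, as a submonoid of the algebra of functions on `(Kˣ)^r`. -/
def monomialSubmonoid (K : Type*) [Field K] (r : ℕ) : Submonoid ((Fin r → Kˣ) → K) where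
  carrier := Set.range fun (a : Fin r → ℤ) x => (monomialChar K a x : K)
  one_mem' := ⟨0, by ext x; simp [monomialChar_apply]⟩
  mul_mem' := by
    rintro _ _ ⟨a, rfl⟩ ⟨b, rfl⟩
    refine ⟨a + b, ?_⟩
    ext x
    simp [monomialChar_apply, zpow_add, Finset.prod_mul_distrib]

/-- The generators are entries of a diagonal matrix or its inverse: each is zero or a coordinate to
the power ±1. -/
lemma comp_diagonalEquiv_mem_adjoin {r : ℕ} {u : diagonalTorus K r → K}
    (hu : u ∈ regularFunctions (diagonalTorus K r)) :
    u ∘ diagonalEquiv K r ∈ Algebra.adjoin K (monomialSubmonoid K r : Set ((Fin r → Kˣ) → K)) := by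
  have key : ∀ (k : ℤ) (i j : Fin r), (fun x : Fin r → Kˣ =>
      Matrix.diagonal (fun l => ((x l ^ k : Kˣ) : K)) i j) ∈
      Algebra.adjoin K (monomialSubmonoid K r : Set ((Fin r → Kˣ) → K)) := by
    intro k i j
    rcases eq_or_ne i j with rfl | hij
    · refine Algebra.subset_adjoin ⟨Pi.single i k, ?_⟩
      ext x
      simp only [monomialChar_single, Matrix.diagonal_apply_eq]
    · simp only [Matrix.diagonal_apply_ne _ hij]
      exact zero_mem _
  induction hu using Algebra.adjoin_induction with
  | mem u hu =>
    rcases hu with ⟨i, j, rfl⟩ | ⟨i, j, rfl⟩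
    · have h : ((fun h : diagonalTorus K r => (h : GL (Fin r) K).val i j) ∘
          diagonalEquiv K r) = fun x : Fin r → Kˣ =>
            Matrix.diagonal (fun l => ((x l ^ (1 : ℤ) : Kˣ) : K)) i j := by
        ext x
        rw [Function.comp_apply, diagonalEquiv_val, diagonalHom_val]
        simp
      rw [h]
      exact key 1 i j
    · have h : ((fun h : diagonalTorus K r => ((h : GL (Fin r) K)⁻¹).val i j) ∘
          diagonalEquiv K r) = fun x : Fin r → Kˣ =>
            Matrix.diagonal (fun l => ((x l ^ (-1 : ℤ) : Kˣ) : K)) i j := by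
        ext x
        rw [Function.comp_apply, diagonalEquiv_val, ← map_inv, diagonalHom_val]
        simp
      rw [h]
      exact key (-1) i j
  | algebraMap c => exact Subalgebra.algebraMap_mem _ c
  | add u v _ _ hu hv => exact add_mem hu hv
  | mul u v _ _ hu hv => exact mul_mem hu hv

/-- Regular characters of `(Kˣ)^r` are Laurent monomials, by linear independence of characters. -/
lemma exists_eq_monomialChar {r : ℕ} (χ : (Fin r → Kˣ) →* Kˣ)
    (hχ : (fun x => (χ x : K)) ∈
      Algebra.adjoin K (monomialSubmonoid K r : Set ((Fin r → Kˣ) → K))) :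
    ∃ a, χ = monomialChar K a := by
  let v : ((Fin r → Kˣ) →* K) → (Fin r → Kˣ) → K := fun f => f
  let s : Set ((Fin r → Kˣ) →* K) :=
    Set.range fun a : Fin r → ℤ => (Units.coeHom K).comp (monomialChar K a)
  have hs : (monomialSubmonoid K r : Set ((Fin r → Kˣ) → K)) = v '' s := by
    rw [← Set.range_comp]; rfl
  -- Monomials are closed under multiplication, so the algebra they generate is merely their linear
  -- span.
  have hmem : v ((Units.coeHom K).comp χ) ∈ Submodule.span K (v '' s) := by
    rw [← hs, ← Submonoid.closure_eq (monomialSubmonoid K r), ← Algebra.adjoin_eq_span]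
    exact hχ
  by_contra! h
  refine (linearIndependent_monoidHom (Fin r → Kˣ) K).notMem_span_image (s := s) ?_ hmem
  rintro ⟨a, ha⟩
  refine h a (MonoidHom.ext fun x => Units.ext ?_)
  exact (DFunLike.congr_fun ha x).symm

lemma monomialChar_eq_one_iff [IsAlgClosed K] {r : ℕ} {a : Fin r → ℤ} :
    monomialChar K a = 1 ↔ a = 0 := by
  refine ⟨fun h => ?_, by rintro rfl; ext x; simp [monomialChar_apply]⟩
  ext i
  by_contra hi
  have : Infinite K := IsAlgClosed.instInfinite
  -- An |a_i|-th root of some c ≠ 0, 1, placed in coordinate i with 1 elsewhere, is a point where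
  -- the monomial is not 1.
  obtain ⟨c, hc⟩ := Set.Infinite.nonempty (Set.toFinite ({0, 1} : Set K)).infinite_compl
  simp only [Set.mem_compl_iff, Set.mem_insert_iff, Set.mem_singleton_iff, not_or] at hc
  obtain ⟨x, hx⟩ := IsAlgClosed.exists_pow_nat_eq c (Int.natAbs_pos.2 hi)
  have hx0 : x ≠ 0 := by
    rintro rfl
    rw [zero_pow (Int.natAbs_ne_zero.2 hi)] at hx
    exact hc.1 hx.symm
  have h1 := DFunLike.congr_fun h (Pi.mulSingle i (Units.mk0 x hx0))
  rw [monomialChar_apply, Finset.prod_eq_single i (fun j _ hj => by simp [hj]) (by simp),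
    Pi.mulSingle_eq_same, MonoidHom.one_apply] at h1
  have h2 : Units.mk0 x hx0 ^ (a i).natAbs = 1 := by
    rwa [pow_natAbs_eq_one]
  have h3 := congrArg Units.val h2
  rw [Units.val_pow_eq_pow_val, Units.val_mk0, hx] at h3
  exact hc.2 h3

/-! ### Duality between a torus and its character lattice -/

section Duality

variable {T : Subgroup (GL (Fin m) K)} {r : ℕ}

/-- The coordinates `(Kˣ)^r ≃ T` given by an isomorphism of `T` with the diagonal torus. -/
def torusCoord (e : diagonalTorus K r ≃* T) : (Fin r → Kˣ) ≃* T :=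
  (diagonalEquiv K r).trans e

lemma exists_charGroup_comp_torusCoord (e : diagonalTorus K r ≃* T) (he : IsRegularMap e)
    (χ : charGroup T) : ∃ a, ∀ x, χ.1 (torusCoord e x) = monomialChar K a x := by
  obtain ⟨a, ha⟩ := exists_eq_monomialChar (χ.1.comp (torusCoord e).toMonoidHom)
    (comp_diagonalEquiv_mem_adjoin (he _ χ.2))
  exact ⟨a, fun x => DFunLike.congr_fun ha x⟩

/-- The coordinate functions on a torus, as characters. -/
def coordChar (e : diagonalTorus K r ≃* T) (he : IsRegularMap e.symm) (i : Fin r) :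
    charGroup T where
  val := (Pi.evalMonoidHom (fun _ : Fin r => Kˣ) i).comp (torusCoord e).symm.toMonoidHom
  property := by
    have h : (fun h : diagonalTorus K r => (h : GL (Fin r) K).val i i) ∈
        regularFunctions (diagonalTorus K r) := Algebra.subset_adjoin (Or.inl ⟨i, i, rfl⟩)
    refine Eq.mp (congrArg (· ∈ regularFunctions T) ?_) (he _ h)
    symm
    ext t
    obtain ⟨x, rfl⟩ := (torusCoord e).surjective t
    have hx : e.symm (torusCoord e x) = diagonalEquiv K r x := e.symm_apply_apply _
    rw [Function.comp_apply, hx, diagonalEquiv_val, diagonalHom_val, Matrix.diagonal_apply_eq]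
    exact congrArg (fun y : Fin r → Kˣ => (y i : K)) ((torusCoord e).symm_apply_apply x)

lemma coordChar_torusCoord (e : diagonalTorus K r ≃* T) (he : IsRegularMap e.symm) (i : Fin r)
    (x : Fin r → Kˣ) : (coordChar e he i).1 (torusCoord e x) = x i :=
  congrFun ((torusCoord e).symm_apply_apply x) i

lemma prod_coordChar_zpow_torusCoord (e : diagonalTorus K r ≃* T) (he : IsRegularMap e.symm)
    (a : Fin r → ℤ) (x : Fin r → Kˣ) :
    (∏ i, coordChar e he i ^ a i).1 (torusCoord e x) = monomialChar K a x := by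
  rw [monomialChar_apply, Subgroup.val_finsetProd, MonoidHom.finsetProd_apply]
  refine Finset.prod_congr rfl fun i _ => ?_
  rw [Subgroup.coe_zpow, MonoidHom.zpow_apply, coordChar_torusCoord]

lemma exists_eq_prod_coordChar_zpow (e : diagonalTorus K r ≃* T) (he : IsRegularMap e)
    (he' : IsRegularMap e.symm) (χ : charGroup T) :
    ∃ a : Fin r → ℤ, χ = ∏ i, coordChar e he' i ^ a i := by
  obtain ⟨a, ha⟩ := exists_charGroup_comp_torusCoord e he χ
  refine ⟨a, Subtype.ext (MonoidHom.ext fun t => ?_)⟩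
  obtain ⟨x, rfl⟩ := (torusCoord e).surjective t
  rw [ha, prod_coordChar_zpow_torusCoord]

/-- The character lattice of a torus is free of finite rank. -/
lemma exists_charGroup_equiv [IsAlgClosed K] (hT : IsTorus T) :
    ∃ r, Nonempty ((Fin r → ℤ) ≃ₗ[ℤ] Additive (charGroup T)) := by
  obtain ⟨-, r, e, he, he'⟩ := hT
  let L : (Fin r → ℤ) →+ Additive (charGroup T) :=
    { toFun := fun a => Additive.ofMul (∏ i, coordChar e he' i ^ a i)
      map_zero' := by simp
      map_add' := fun a b => by
        simp [zpow_add, Finset.prod_mul_distrib] }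
  refine ⟨r, ⟨LinearEquiv.ofBijective L.toIntLinearMap ⟨?_, ?_⟩⟩⟩
  · refine (injective_iff_map_eq_zero L).2 fun a ha => ?_
    rw [← monomialChar_eq_one_iff (K := K)]
    refine MonoidHom.ext fun x => ?_
    rw [← prod_coordChar_zpow_torusCoord e he']
    exact DFunLike.congr_fun (congrArg Subtype.val ha) (torusCoord e x)
  · intro χ
    obtain ⟨a, ha⟩ := exists_eq_prod_coordChar_zpow e he he' χ.toMul
    exact ⟨a, ha.symm⟩

/-- A torus is the dual of its character lattice. -/
lemma existsUnique_forall_charGroup_eq (hT : IsTorus T) (ψ : charGroup T →* Kˣ) :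
    ∃! t : T, ∀ χ, χ.1 t = ψ χ := by
  obtain ⟨-, r, e, he, he'⟩ := hT
  -- The values on the coordinate characters are the coordinates of the point, and these characters
  -- generate the group.
  refine ⟨torusCoord e fun i => ψ (coordChar e he' i), fun χ => ?_, fun t ht => ?_⟩
  · obtain ⟨a, rfl⟩ := exists_eq_prod_coordChar_zpow e he he' χ
    rw [prod_coordChar_zpow_torusCoord, monomialChar_apply, map_prod]
    simp only [map_zpow]
  · obtain ⟨x, rfl⟩ := (torusCoord e).surjective t
    congr 1
    ext1 i
    rw [← ht, coordChar_torusCoord]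

/-- The points of a torus annihilated by a sublattice `N` of its character lattice `M` are the
homomorphisms from `M / N` to `Kˣ`. -/
lemma card_annihilator (hT : IsTorus T) (N : Submodule ℤ (Additive (charGroup T))) :
    Nat.card {t : T // ∀ χ ∈ N, χ.toMul.1 t = 1} =
      Nat.card (Multiplicative (Additive (charGroup T) ⧸ N) →* Kˣ) := by
  let res : (Multiplicative (Additive (charGroup T) ⧸ N) →* Kˣ) → (charGroup T →* Kˣ) := fun g =>
    g.comp (AddMonoidHom.toMultiplicativeRight N.mkQ.toAddMonoidHom)
  have hres : ∀ g χ, res g χ = g (Multiplicative.ofAdd (N.mkQ (Additive.ofMul χ))) :=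
    fun _ _ => rfl
  choose pt hpt huniq using fun ψ => existsUnique_forall_charGroup_eq hT ψ
  symm
  refine Nat.card_eq_of_bijective (fun g => ⟨pt (res g), fun χ hχ => ?_⟩) ⟨?_, ?_⟩
  · rw [hpt, hres]
    have : N.mkQ (Additive.ofMul χ.toMul) = 0 := (Submodule.Quotient.mk_eq_zero N).2 hχ
    rw [this]
    exact map_one g
  · intro g g' h
    have h' : pt (res g) = pt (res g') := congrArg Subtype.val h
    refine MonoidHom.ext fun y => ?_
    obtain ⟨χ, hχ⟩ := N.mkQ_surjective y.toAdd
    have := hpt (res g) χ.toMul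
    rw [h', hpt, hres, hres] at this
    have hy : y = Multiplicative.ofAdd (N.mkQ (Additive.ofMul χ.toMul)) := hχ.symm
    rw [hy, this]
  · rintro ⟨t, ht⟩
    -- For surjectivity: evaluation at `t` kills `N`, hence descends to the quotient.
    let ev : Additive (charGroup T) →+ Additive Kˣ :=
      { toFun := fun χ => Additive.ofMul (χ.toMul.1 t)
        map_zero' := rfl
        map_add' := fun _ _ => rfl }
    let g : Additive (charGroup T) ⧸ N →+ Additive Kˣ :=
      (N.liftQ ev.toIntLinearMap fun χ hχ => ht χ hχ).toAddMonoidHom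
    refine ⟨AddMonoidHom.toMultiplicativeLeft g, Subtype.ext ?_⟩
    exact (huniq _ t fun χ => rfl).symm

end Duality

/-! ### Homomorphisms from finite `2`-groups to `Kˣ` -/

/-- The exponent of `A` is a power of 2, hence nonzero in `K`, so `K` has enough roots of unity for
`A` and its dual to have equal order. -/
lemma card_monoidHom_units_of_two_ne_zero [IsAlgClosed K] {A : Type*} [CommGroup A] {h : ℕ}
    (hA : Nat.card A = 2 ^ h) (hK : ringChar K ≠ 2) : Nat.card (A →* Kˣ) = 2 ^ h := by
  have : Finite A := Nat.finite_of_card_ne_zero (by rw [hA]; positivity)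
  obtain ⟨k, -, hk⟩ := (Nat.dvd_prime_pow Nat.prime_two).1 (hA ▸ Group.exponent_dvd_nat_card)
  have : NeZero ((Monoid.exponent A : ℕ) : K) := ⟨by
    rw [hk, Nat.cast_pow]
    exact pow_ne_zero _ (by exact_mod_cast Ring.two_ne_zero hK)⟩
  rw [CommGroup.card_monoidHom_of_hasEnoughRootsOfUnity, hA]

/-- In characteristic 2 the Frobenius is injective, so 1 is the only 2^h-th root of unity. -/
lemma card_monoidHom_units_of_two_eq_zero {A : Type*} [CommGroup A] {h : ℕ}
    (hA : Nat.card A = 2 ^ h) (hK : ringChar K = 2) : Nat.card (A →* Kˣ) = 1 := by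
  have : CharP K 2 := ringChar.of_eq hK
  have h1 : ∀ g : A →* Kˣ, g = 1 := by
    intro g
    ext x
    have hx : ((g x : K)) ^ 2 ^ h = 1 := by
      rw [← Units.val_pow_eq_pow_val, ← map_pow, ← hA, pow_card_eq_one', map_one, Units.val_one]
    have := (ExpChar.pow_prime_pow_mul_eq_one_iff 2 h 1 (g x : K)).1 (by simpa using hx)
    simpa using this
  exact Nat.card_eq_one_iff_unique.2 ⟨⟨fun a b => (h1 a).trans (h1 b).symm⟩, ⟨1⟩⟩

end

end TorusFixedPoints

/-! ### Counting the fixed points of a Weyl group element -/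

open TorusFixedPoints in
theorem mainTheorem7 {K : Type*} [Field K] [IsAlgClosed K] {m : ℕ}
    (G T : Subgroup (GL (Fin m) K))
    (hG : TorusFixedPoints.IsSimpleAlgebraicGroup G)
    (hT : TorusFixedPoints.IsMaximalTorus G T)
    (n : ℕ) (Φ : TorusFixedPoints.ClassicalType)
    (e : TorusFixedPoints.RatChar T ≃ₗ[ℚ] (Fin n → ℚ))
    (he : TorusFixedPoints.IsRootIso G T n Φ e)
    (w : TorusFixedPoints.Weyl G T)
    (hw : TorusFixedPoints.IsElliptic G hT.isTorus w)
    (p : n.Partition)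
    (hp : TorusFixedPoints.CorrespondsTo G hT.isTorus e w p)
    (hD : Φ = TorusFixedPoints.ClassicalType.D → Even p.parts.card) :
    (ringChar K ≠ 2 → TorusFixedPoints.tau G hT.isTorus w = 2 ^ p.parts.card) ∧
    (ringChar K = 2 → TorusFixedPoints.tau G hT.isTorus w = 1) := by
  obtain ⟨r, ⟨L⟩⟩ := exists_charGroup_equiv hT.isTorus
  have : Module.Free ℤ (Additive (charGroup T)) := Module.Free.of_equiv L
  have : Module.Finite ℤ (Additive (charGroup T)) := Module.Finite.equiv L
  obtain ⟨π, ε, hπ, hparts⟩ := hp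
  let f : Additive (charGroup T) →ₗ[ℤ] Additive (charGroup T) :=
    (weylChar G hT.isTorus w).toAdditive.toIntLinearMap
  -- `stdRep` at `w` is by definition the base change of `f`, so `hπ` and `hw` apply as they stand.
  have hcard := card_quotient_range_sub_id f e π ε hπ hw
  rw [hparts] at hcard
  have htau : tau G hT.isTorus w =
      Nat.card (Multiplicative (Additive (charGroup T) ⧸ LinearMap.range (f - LinearMap.id)) →*
        Kˣ) := by
    rw [← card_annihilator hT.isTorus]
    refine Nat.card_congr (Equiv.subtypeEquivRight fun t => ?_)
    -- The action on characters is through `w⁻¹`, which has the same fixed points as `w`.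
    have hinv : weylAut G hT.isTorus w t = t ↔ weylAut G hT.isTorus w⁻¹ t = t := by
      rw [map_inv, MulAut.inv_apply, MulEquiv.symm_apply_eq, eq_comm]
    have hf : ∀ χ : Additive (charGroup T),
        ((f - LinearMap.id : Additive (charGroup T) →ₗ[ℤ] _) χ).toMul.1 t =
        χ.toMul.1 (weylAut G hT.isTorus w⁻¹ t) / χ.toMul.1 t := fun χ => rfl
    rw [hinv]
    constructor
    · rintro ht _ ⟨χ, rfl⟩
      rw [hf, ht, div_self']
    · intro ht
      -- Characters separate points: `t` and its image both realize evaluation at `t`.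
      let ψ : charGroup T →* Kˣ :=
        { toFun := fun χ => χ.1 t, map_one' := rfl, map_mul' := fun _ _ => rfl }
      refine (existsUnique_forall_charGroup_eq hT.isTorus ψ).unique (fun χ => ?_) fun χ => rfl
      have := ht _ ⟨Additive.ofMul χ, rfl⟩
      rw [hf, div_eq_one] at this
      exact this
  rw [htau]
  exact ⟨card_monoidHom_units_of_two_ne_zero hcard, card_monoidHom_units_of_two_eq_zero hcard⟩
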